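/- Let $H(x)=-x\log_2 x-(1-x)\log_2(1-x)$ be the binary entropy function and let $H^{-1}:[0,1]\to[0,\tfrac12]$ be the inverse of its restriction to $[0,\tfrac12]$. For a real $k>1$ and $n\in\mathbb N$, the family $\mathcal H^k_{\mathrm{Rennes}}(n,n)$ consists of the random hash functions $h:\{0,1\}^n\to\{0,1\}^n$, $h(x)=Ax+b$ over $\mathbb F_2$, where all entries of $A\in\mathbb F_2^{n\times n}$ and $b\in\mathbb F_2^n$ are independent, the entries of the $i$-th row of $A$ are $\mathrm{Bern}(p_i)$, the entries of $b$ are $\mathrm{Bern}(\tfrac12)$, and the densities satisfy $p_1\ge p_2\ge\dots\ge p_n$, $p_i\in(0,\tfrac12]$ and $$p_i\ \ge\ \min\Big(\tfrac12,\ \frac{16}{H^{-1}(\delta_i)}\cdot\frac{\log_2 i}{i}\Big),\qquad \delta_i=\frac{i}{i+\log_2 k}\qquad(1\le i\le n).$$ For $S\subseteq\{0,1\}^n$, $\alpha\in\{0,1\}^n$ and $m\le n$ let $\mathrm{Cell}_{S,m}$ be the set of all $y\in S$ such that $h(y)$ and $\alpha$ agree in the first $m$ coordinates. For $\rho>0$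 and $\mathsf{qs}\in\mathbb N$, the random hash function $h$ is called prefix-$(\rho,\mathsf{qs},k)$-concentrated if for all $m$ with $\mathsf{qs}\le m\le n$, all $S\subseteq\{0,1\}^n$ with $|S|\le 2^m k$ and all $\alpha\in\{0,1\}^n$, $$\mathsf E\big[|\mathrm{Cell}_{S,m}|\big]=\frac{|S|}{2^m}\qquad\text{and}\qquad \frac{\sigma^2\big[|\mathrm{Cell}_{S,m}|\big]}{\mathsf E\big[|\mathrm{Cell}_{S,m}|\big]}\le\rho$$ (the quotient being read as $0$ for $S=\emptyset$). **Theorem.** For every $k>1$ and $\rho>1$ there is an $n_0=n_0(k,\rho)$ such that for every $n\ge n_0$ there is a $\mathsf{qs}\le n$, with $\mathsf{qs}\le\max(n_0,\lceil n/200\rceil)$, such that for every choice of densities as above, every $m$ with $\mathsf{qs}\le m\le n$, every $S\subseteq\{0,1\}^n$ with $|S|\le 2^m k$ and every $\alpha\in\{0,1\}^n$, $$\mathsf E\big[|\mathrm{Cell}_{S,m}|\big]=\frac{|S|}{2^m}\qquad\text{and}\qquad \frac{\sigma^2\big[|\mathrm{Cell}_{S,m}|\big]}{\mathsf E\big[|\mathrm{Cell}_{S,m}|\big]}\le\rho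 .$$ Hence $\mathcal H^k_{\mathrm{Rennes}}(n,n)$ is prefix-$(\rho,\mathsf{qs},k)$-concentrated. -/

import Mathlib

open MeasureTheory ProbabilityTheory
open scoped unitInterval

noncomputable section

namespace Hashing

/-- The cube `{0,1}^n`, as the vector space `𝔽₂^n`. -/
abbrev Cube (n : ℕ) : Type := Fin n → ZMod 2

/-- The binary entropy function in bits. -/
def binEntropy₂ (x : ℝ) : ℝ := Real.binEntropy x / Real.log 2

/-- The binary entropy function is a bijection from `[0,1/2]` onto `[0,1]`. -/
theorem bijOn_binEntropy₂ : Set.BijOn binEntropy₂ (Set.Icc 0 (1 / 2)) (Set.Icc 0 1) := by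
  have hlog : 0 < Real.log 2 := Real.log_pos one_lt_two
  refine ⟨fun x hx => ?_, fun x hx y hy h => ?_, fun y hy => ?_⟩
  · exact ⟨div_nonneg (Real.binEntropy_nonneg hx.1 (by linarith [hx.2])) hlog.le,
      (div_le_one hlog).2 Real.binEntropy_le_log_two⟩
  · rw [one_div] at hx hy
    exact Real.binEntropy_strictMonoOn.injOn hx hy ((div_left_inj' hlog.ne').1 h)
  · have hc : ContinuousOn binEntropy₂ (Set.Icc 0 (1 / 2)) :=
      (Real.binEntropy_continuous.div_const _).continuousOn
    refine intermediate_value_Icc (by norm_num) hc ?_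
    simpa [binEntropy₂, div_self hlog.ne'] using hy

/-- The inverse `H⁻¹ : [0,1] → [0,1/2]` of the binary entropy function. -/
def invBinEntropy₂ : ℝ → ℝ := Function.invFunOn binEntropy₂ (Set.Icc 0 (1 / 2))

theorem invBinEntropy₂_mem {y : ℝ} (hy : y ∈ Set.Icc (0 : ℝ) 1) :
    invBinEntropy₂ y ∈ Set.Icc (0 : ℝ) (1 / 2) :=
  Function.invFunOn_mem (bijOn_binEntropy₂.surjOn hy)

theorem binEntropy₂_invBinEntropy₂ {y : ℝ} (hy : y ∈ Set.Icc (0 : ℝ) 1) :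
    binEntropy₂ (invBinEntropy₂ y) = y :=
  Function.invFunOn_eq (bijOn_binEntropy₂.surjOn hy)

/-- The affine map `x ↦ A x + b` over `𝔽₂`. The rows of `A` are indexed by the first argument. -/
def affineHash {n : ℕ} (Ab : (Fin n → Fin n → ZMod 2) × (Fin n → ZMod 2)) : Cube n → Cube n :=
  fun x => (Matrix.of Ab.1).mulVec x + Ab.2

/-- The law of `(A, b)`: all entries are independent, those of the `i`-th row of `A` have law
`Bern(p i)` and those of `b` have law `Bern(1/2)`. -/
def matrixLaw {n : ℕ} (p : Fin n → I) :
    Measure ((Fin n → Fin n → ZMod 2) × (Fin n → ZMod 2)) :=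
  (Measure.pi fun i => Measure.pi fun _ : Fin n => bernoulliMeasure (1 : ZMod 2) 0 (p i)).prod
    (Measure.pi fun _ : Fin n => bernoulliMeasure (1 : ZMod 2) 0 ⟨1 / 2, by norm_num, by norm_num⟩)

/-- The random hash function `h(x) = A x + b` with row densities `p`, given by its law on the
functions from `{0,1}^n` to `{0,1}^n`. -/
def affineHashLaw {n : ℕ} (p : Fin n → I) : Measure (Cube n → Cube n) :=
  (matrixLaw p).map affineHash

instance {n : ℕ} (p : Fin n → I) : IsProbabilityMeasure (matrixLaw p) := by
  unfold matrixLaw; infer_instance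

theorem measurable_affineHash {n : ℕ} : Measurable (affineHash (n := n)) :=
  measurable_of_countable _

instance {n : ℕ} (p : Fin n → I) : IsProbabilityMeasure (affineHashLaw p) :=
  Measure.isProbabilityMeasure_map measurable_affineHash.aemeasurable

/-- `Cell_{S,m}`: the elements of `S` whose hash value agrees with `α` on the first `m`
coordinates. -/
def cell {n : ℕ} (S : Finset (Cube n)) (m : ℕ) (α : Cube n) (h : Cube n → Cube n) :
    Finset (Cube n) :=
  S.filter fun y => ∀ i : Fin n, (i : ℕ) < m → h y i = α i

/-- The random variable `|Cell_{S,m}|`. -/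
def cellCount {n : ℕ} (S : Finset (Cube n)) (m : ℕ) (α : Cube n) (h : Cube n → Cube n) : ℝ :=
  ((cell S m α h).card : ℝ)

/-- The dispersion index: the quotient of the variance by the expectation. -/
def dispersionIndex {Ω : Type*} [MeasurableSpace Ω] (X : Ω → ℝ) (P : Measure Ω) : ℝ :=
  variance X P / ∫ ω, X ω ∂P

/-- A random hash function with law `P` is prefix-`(ρ, qs, k)`-concentrated. -/
def PrefixConcentrated {n : ℕ} (P : Measure (Cube n → Cube n)) (ρ : ℝ) (qs : ℕ) (k : ℝ) : Prop :=
  ∀ m : ℕ, qs ≤ m → m ≤ n → ∀ S : Finset (Cube n), (S.card : ℝ) ≤ k * 2 ^ m → ∀ α : Cube n,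
    ∫ h, cellCount S m α h ∂P = (S.card : ℝ) / 2 ^ m ∧
      dispersionIndex (cellCount S m α) P ≤ ρ

/-- The lower bound `min(1/2, (16 / H⁻¹(δ)) · log₂ i / i)`, with `δ = i / (i + log₂ k)`, on the
density of the `i`-th row (rows are numbered from `1`). -/
def rennesBound (k : ℝ) (i : ℕ) : ℝ :=
  min (1 / 2)
    (16 / invBinEntropy₂ ((i : ℝ) / ((i : ℝ) + Real.logb 2 k)) * (Real.logb 2 i / (i : ℝ)))

/-- The row densities allowed in the family `H_Rennes^k(n,n)`; row number `i + 1` has index `i`. -/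
structure IsRennesDensity {n : ℕ} (k : ℝ) (p : Fin n → I) : Prop where
  pos : ∀ i, 0 < (p i : ℝ)
  le_half : ∀ i, (p i : ℝ) ≤ 1 / 2
  antitone : Antitone p
  bound_le : ∀ i : Fin n, rennesBound k ((i : ℕ) + 1) ≤ (p i : ℝ)

end Hashing

end

namespace Hashing

/-! ### Moments of the cell counts -/

theorem integral_bernoulliMeasure_zmod_two (p : I) (f : ZMod 2 → ℝ) :
    ∫ a, f a ∂(bernoulliMeasure (1 : ZMod 2) 0 p) = p * f 1 + (1 - p) * f 0 := by
  rw [bernoulliMeasure_def, integral_add_measure (.of_finite) (.of_finite),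
    integral_smul_nnreal_measure, integral_smul_nnreal_measure, integral_dirac, integral_dirac]
  simp [NNReal.smul_def]

theorem zmod_two_eq_zero_or_one : ∀ a : ZMod 2, a = 0 ∨ a = 1 := by decide

theorem zmod_two_one_add_one : (1 + 1 : ZMod 2) = 0 := by decide

/-- The nontrivial real-valued additive character of `𝔽₂`. -/
noncomputable def parity (a : ZMod 2) : ℝ := if a = 0 then 1 else -1

theorem parity_add (a b : ZMod 2) : parity (a + b) = parity a * parity b := by
  rcases zmod_two_eq_zero_or_one a with rfl | rfl <;>
    rcases zmod_two_eq_zero_or_one b with rfl | rfl <;> simp [parity, zmod_two_one_add_one]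

theorem parity_sum {ι : Type*} (s : Finset ι) (f : ι → ZMod 2) :
    parity (∑ i ∈ s, f i) = ∏ i ∈ s, parity (f i) := by
  classical
  induction s using Finset.induction_on with
  | empty => simp [parity]
  | insert a s ha ih => rw [Finset.sum_insert ha, Finset.prod_insert ha, parity_add, ih]

theorem ite_eq_parity (a b : ZMod 2) :
    (if a = b then (1 : ℝ) else 0) = (1 + parity (a + b)) / 2 := by
  rcases zmod_two_eq_zero_or_one a with rfl | rfl <;>
    rcases zmod_two_eq_zero_or_one b with rfl | rfl <;> simp [parity, zmod_two_one_add_one]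

theorem integral_parity_mul (p : I) (a b : ZMod 2) :
    ∫ r, parity (r * a + r * b) ∂(bernoulliMeasure (1 : ZMod 2) 0 p) =
      if a ≠ b then 1 - 2 * (p : ℝ) else 1 := by
  rw [integral_bernoulliMeasure_zmod_two]
  have h : a + b = 0 ↔ a = b := by revert a b; decide
  by_cases hab : a = b
  · rw [if_neg (not_not.2 hab)]
    simp [parity, h.2 hab]
  · simp [parity, h, hab]; ring

/-- The probability that a random row with independent `Bern(p)` entries takes the same value on
two vectors depends only on their Hamming distance. -/
theorem integral_row_agree {n : ℕ} (p : I) (x y : Cube n) :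
    ∫ r, (if r ⬝ᵥ x = r ⬝ᵥ y then (1 : ℝ) else 0)
        ∂(Measure.pi fun _ : Fin n => bernoulliMeasure (1 : ZMod 2) 0 p) =
      (1 + (1 - 2 * (p : ℝ)) ^ hammingDist x y) / 2 := by
  have h : ∀ r : Fin n → ZMod 2, (if r ⬝ᵥ x = r ⬝ᵥ y then (1 : ℝ) else 0) =
      (1 + ∏ j, parity (r j * x j + r j * y j)) / 2 := fun r => by
    rw [ite_eq_parity, ← parity_sum, Finset.sum_add_distrib]; rfl
  simp_rw [h]
  rw [integral_div, integral_add (.of_finite) (.of_finite),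
    integral_fintype_prod_eq_prod (fun j r => parity (r * x j + r * y j))]
  simp_rw [integral_parity_mul, Finset.prod_ite, hammingDist]
  simp

theorem sum_shift_agree (r s a : ZMod 2) :
    (1 / 2 : ℝ) * (if r + 1 = a ∧ s + 1 = a then 1 else 0) +
      (1 - 1 / 2) * (if r + 0 = a ∧ s + 0 = a then 1 else 0) =
    1 / 2 * if r = s then 1 else 0 := by
  rcases zmod_two_eq_zero_or_one r with rfl | rfl <;>
    rcases zmod_two_eq_zero_or_one s with rfl | rfl <;>
    rcases zmod_two_eq_zero_or_one a with rfl | rfl <;> simp [zmod_two_one_add_one] <;> norm_num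

/-- The indicator of the event that the hash values of `x` and `y` both agree with `α` on the first
`m` coordinates. -/
noncomputable def bothHit {n : ℕ} (m : ℕ) (α x y : Cube n) (h : Cube n → Cube n) : ℝ :=
  ∏ i : Fin n, if (i : ℕ) < m then (if h x i = α i ∧ h y i = α i then 1 else 0) else 1

/-- The probability that the hash values of two vectors at distance `d` agree on the first `m`
coordinates. -/
noncomputable def collisionProb {n : ℕ} (p : Fin n → I) (m d : ℕ) : ℝ :=
  ∏ i : Fin n, if (i : ℕ) < m then (1 + (1 - 2 * (p i : ℝ)) ^ d) / 2 else 1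

theorem card_filter_lt {n m : ℕ} (hm : m ≤ n) :
    (Finset.univ.filter fun i : Fin n => (i : ℕ) < m).card = m := by
  rw [Fin.card_filter_val_lt]; simpa using hm

theorem integral_bothHit {n : ℕ} (p : Fin n → I) {m : ℕ} (hm : m ≤ n) (α x y : Cube n) :
    ∫ h, bothHit m α x y h ∂(affineHashLaw p) =
      (1 / 2) ^ m * collisionProb p m (hammingDist x y) := by
  rw [affineHashLaw, integral_map measurable_affineHash.aemeasurable
    (measurable_of_countable _).aestronglyMeasurable, matrixLaw, integral_prod _ (.of_finite)]
  have inner : ∀ A : Fin n → Fin n → ZMod 2,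
      ∫ b, bothHit m α x y (affineHash (A, b)) ∂(Measure.pi fun _ : Fin n =>
        bernoulliMeasure (1 : ZMod 2) 0 ⟨1 / 2, by norm_num, by norm_num⟩) =
      ∏ i : Fin n, if (i : ℕ) < m then
        1 / 2 * (if A i ⬝ᵥ x = A i ⬝ᵥ y then (1 : ℝ) else 0) else 1 := fun A => by
    have := integral_fintype_prod_eq_prod (𝕜 := ℝ)
      (μ := fun _ : Fin n => bernoulliMeasure (1 : ZMod 2) 0 ⟨1 / 2, by norm_num, by norm_num⟩)
      (fun (i : Fin n) b => if (i : ℕ) < m then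
        (if A i ⬝ᵥ x + b = α i ∧ A i ⬝ᵥ y + b = α i then (1 : ℝ) else 0) else 1)
    refine this.trans (Finset.prod_congr rfl fun i _ => ?_)
    rw [integral_bernoulliMeasure_zmod_two]
    by_cases hi : (i : ℕ) < m
    · simp only [if_pos hi]
      exact sum_shift_agree _ _ _
    · simp [hi]
  simp_rw [inner]
  rw [integral_fintype_prod_eq_prod (𝕜 := ℝ) (fun (i : Fin n) r => if (i : ℕ) < m then
    1 / 2 * (if r ⬝ᵥ x = r ⬝ᵥ y then (1 : ℝ) else 0) else 1)]
  have : (1 / 2 : ℝ) ^ m = ∏ i : Fin n, if (i : ℕ) < m then (1 / 2 : ℝ) else 1 := by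
    rw [Finset.prod_ite, Finset.prod_const, Finset.prod_const_one, card_filter_lt hm, mul_one]
  rw [this, collisionProb, ← Finset.prod_mul_distrib]
  refine Finset.prod_congr rfl fun i _ => ?_
  split_ifs with hi
  · rw [integral_const_mul, integral_row_agree]
  · simp

theorem bothHit_eq_ite {n : ℕ} (m : ℕ) (α x y : Cube n) (h : Cube n → Cube n) :
    bothHit m α x y h = (if ∀ i : Fin n, (i : ℕ) < m → h x i = α i then 1 else 0) *
      (if ∀ i : Fin n, (i : ℕ) < m → h y i = α i then 1 else 0) := by
  rw [bothHit, ite_zero_mul_ite_zero, mul_one]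
  split_ifs with hc
  · refine Finset.prod_eq_one fun i _ => ?_
    split_ifs with hi hi'
    · rfl
    · exact absurd ⟨hc.1 i hi, hc.2 i hi⟩ hi'
    · rfl
  · have : ∃ i : Fin n, (i : ℕ) < m ∧ ¬(h x i = α i ∧ h y i = α i) := by
      by_contra! hcon
      exact hc ⟨fun i hi => (hcon i hi).1, fun i hi => (hcon i hi).2⟩
    obtain ⟨i, hi, hi'⟩ := this
    exact Finset.prod_eq_zero (Finset.mem_univ i) (by rw [if_pos hi, if_neg hi'])

theorem cellCount_eq_sum {n : ℕ} (S : Finset (Cube n)) (m : ℕ) (α : Cube n)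
    (h : Cube n → Cube n) :
    cellCount S m α h = ∑ x ∈ S, bothHit m α x x h := by
  rw [cellCount, cell, Finset.card_filter, Nat.cast_sum]
  refine Finset.sum_congr rfl fun x _ => ?_
  rw [bothHit_eq_ite]
  split_ifs <;> simp

theorem cellCount_sq_eq_sum {n : ℕ} (S : Finset (Cube n)) (m : ℕ) (α : Cube n)
    (h : Cube n → Cube n) :
    cellCount S m α h ^ 2 = ∑ x ∈ S, ∑ y ∈ S, bothHit m α x y h := by
  rw [cellCount, cell, Finset.card_filter, Nat.cast_sum, sq, Finset.sum_mul_sum]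
  refine Finset.sum_congr rfl fun x _ => Finset.sum_congr rfl fun y _ => ?_
  rw [bothHit_eq_ite]
  split_ifs <;> simp

theorem collisionProb_zero {n : ℕ} (p : Fin n → I) (m : ℕ) : collisionProb p m 0 = 1 := by
  refine Finset.prod_eq_one fun i _ => ?_
  split_ifs <;> norm_num

theorem integral_cellCount {n : ℕ} (p : Fin n → I) {m : ℕ} (hm : m ≤ n) (S : Finset (Cube n))
    (α : Cube n) : ∫ h, cellCount S m α h ∂(affineHashLaw p) = (S.card : ℝ) / 2 ^ m := by
  simp_rw [cellCount_eq_sum]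
  rw [integral_finsetSum _ fun _ _ => .of_finite]
  simp_rw [integral_bothHit p hm, hammingDist_self, collisionProb_zero]
  simp [div_eq_mul_inv]

theorem variance_cellCount {n : ℕ} (p : Fin n → I) {m : ℕ} (hm : m ≤ n) (S : Finset (Cube n))
    (α : Cube n) : variance (cellCount S m α) (affineHashLaw p) =
      (1 / 2) ^ m * ∑ x ∈ S, ∑ y ∈ S, (collisionProb p m (hammingDist x y) - (1 / 2) ^ m) := by
  have hsq : ∫ h, cellCount S m α h ^ 2 ∂(affineHashLaw p) =
      (1 / 2) ^ m * ∑ x ∈ S, ∑ y ∈ S, collisionProb p m (hammingDist x y) := by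
    simp_rw [cellCount_sq_eq_sum]
    rw [integral_finsetSum _ fun _ _ => .of_finite, Finset.mul_sum]
    refine Finset.sum_congr rfl fun x _ => ?_
    rw [integral_finsetSum _ fun _ _ => .of_finite, Finset.mul_sum]
    exact Finset.sum_congr rfl fun y _ => integral_bothHit p hm α x y
  rw [variance_eq_sub .of_discrete, integral_cellCount p hm]
  simp only [Pi.pow_apply, hsq, Finset.sum_sub_distrib, Finset.sum_const, nsmul_eq_mul]
  rw [one_div_pow]
  ring

/-- The dispersion index is bounded once every row sum of the excess collision probabilities is. -/
theorem dispersionIndex_cellCount_le {n : ℕ} (p : Fin n → I) {m : ℕ} (hm : m ≤ n)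
    (S : Finset (Cube n)) (α : Cube n) {ρ : ℝ} (hρ : 0 ≤ ρ)
    (h : ∀ x ∈ S, ∑ y ∈ S, (collisionProb p m (hammingDist x y) - (1 / 2) ^ m) ≤ ρ) :
    dispersionIndex (cellCount S m α) (affineHashLaw p) ≤ ρ := by
  rw [dispersionIndex, integral_cellCount p hm, variance_cellCount p hm]
  refine div_le_of_le_mul₀ (by positivity) hρ ?_
  calc _ ≤ (1 / 2) ^ m * (S.card • ρ) := by gcongr; exact Finset.sum_le_card_nsmul _ _ _ h
    _ = _ := by rw [nsmul_eq_mul, one_div_pow]; ring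

/-! ### Estimates of the collision probabilities -/

theorem sum_pow_hammingDist {n : ℕ} (x : Cube n) (r : ℝ) :
    ∑ y, r ^ hammingDist x y = (1 + r) ^ n := by
  have h : ∀ y : Cube n, r ^ hammingDist x y = ∏ j, if x j ≠ y j then r else 1 := fun y => by
    simp [Finset.prod_ite, hammingDist]
  have hs : ∀ a : ZMod 2, ∑ b, (if a ≠ b then r else 1) = 1 + r := fun a => by
    have h1 : (Finset.univ.filter fun b => a ≠ b).card = 1 := by revert a; decide
    have h2 : (Finset.univ.filter fun b => ¬a ≠ b).card = 1 := by revert a; decide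
    rw [Finset.sum_ite, Finset.sum_const, Finset.sum_const, h1, h2, one_smul, one_smul, add_comm]
  simp_rw [h]
  have := Finset.prod_univ_sum (fun _ : Fin n => (Finset.univ : Finset (ZMod 2)))
    (fun j b => if x j ≠ b then r else 1)
  rw [Fintype.piFinset_univ] at this
  rw [← this, Finset.prod_congr rfl fun j _ => hs (x j), Finset.prod_const, Finset.card_univ,
    Fintype.card_fin]

theorem collisionProb_le {n : ℕ} {p : Fin n → I} {m : ℕ} (hm : m ≤ n) {t : ℝ}
    (h0 : ∀ i, (p i : ℝ) ≤ 1 / 2) (ht : ∀ i : Fin n, (i : ℕ) < m → 1 - 2 * (p i : ℝ) ≤ t) (d : ℕ) :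
    collisionProb p m d ≤ ((1 + t ^ d) / 2) ^ m := by
  have h : ((1 + t ^ d) / 2) ^ m = ∏ i : Fin n, if (i : ℕ) < m then (1 + t ^ d) / 2 else 1 := by
    rw [Finset.prod_ite, Finset.prod_const, Finset.prod_const_one, card_filter_lt hm, mul_one]
  rw [h]
  have hp : ∀ i, 0 ≤ 1 - 2 * (p i : ℝ) := fun i => by linarith [h0 i]
  refine Finset.prod_le_prod (fun i _ => ?_) fun i _ => ?_
  · have := pow_nonneg (hp i) d
    split_ifs <;> positivity
  · split_ifs with hi
    · have := pow_le_pow_left₀ (hp i) (ht i hi) d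
      linarith
    · rfl

theorem one_add_exp_neg_div_two_le {z : ℝ} (h0 : 0 ≤ z) (h2 : z ≤ 2) :
    (1 + Real.exp (-z)) / 2 ≤ Real.exp (-(z / 4)) := by
  have h : (1 + Real.exp (-z)) / 2 = Real.exp (-(z / 2)) * Real.cosh (z / 2) := by
    rw [Real.cosh_eq, mul_div_assoc', mul_add, ← Real.exp_add, ← Real.exp_add]
    ring_nf
    rw [Real.exp_zero]
    ring
  calc _ = Real.exp (-(z / 2)) * Real.cosh (z / 2) := h
    _ ≤ Real.exp (-(z / 2)) * Real.exp ((z / 2) ^ 2 / 2) := by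
      gcongr; exact Real.cosh_le_exp_half_sq _
    _ ≤ _ := by
      rw [← Real.exp_add, Real.exp_le_exp]
      nlinarith

/-- With row density about `32 log m / m`, the collision probability at distance `d` exceeds that
of a uniformly random hash by little more than a geometrically decaying term. -/
theorem collision_excess_le {m : ℕ} (hm : 2 ≤ m) (d : ℕ) :
    ((1 + Real.exp (-(64 * Real.log m / m)) ^ d) / 2) ^ m - (1 / 2) ^ m ≤
      Real.exp (-(16 * Real.log m)) ^ d + Real.exp (-(m / 4)) * Real.exp (-8) ^ d +
        (1 / 2) ^ m * (Real.exp (1 / m) - 1) := by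
  have hm0 : (0 : ℝ) < m := by positivity
  have hlog : 0 ≤ Real.log m := Real.log_natCast_nonneg m
  set z : ℝ := 64 * Real.log m / m * d with hz
  have hz0 : 0 ≤ z := by positivity
  have hpow : Real.exp (-(64 * Real.log m / m)) ^ d = Real.exp (-z) := by
    rw [← Real.exp_nat_mul, hz]; ring_nf
  have ha : 0 ≤ Real.exp (-(16 * Real.log m)) ^ d := by positivity
  have hb : 0 ≤ Real.exp (-(m / 4)) * Real.exp (-8) ^ d := by positivity
  have hc : 0 ≤ (1 / 2 : ℝ) ^ m * (Real.exp (1 / m) - 1) :=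
    mul_nonneg (by positivity) (sub_nonneg.2 (Real.one_le_exp (by positivity)))
  have hu : (0 : ℝ) ≤ (1 / 2) ^ m := by positivity
  rw [hpow]
  rcases le_or_gt z 2 with h2 | h2
  · have h1 : ((1 + Real.exp (-z)) / 2) ^ m ≤ Real.exp (-(16 * Real.log m)) ^ d := by
      calc _ ≤ Real.exp (-(z / 4)) ^ m := by gcongr; exact one_add_exp_neg_div_two_le hz0 h2
        _ = _ := by
          rw [← Real.exp_nat_mul, ← Real.exp_nat_mul, hz]
          congr 1
          field_simp
          ring
    linarith
  rcases le_or_gt (d : ℝ) (m / 32) with hd | hd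
  · have h1 : ((1 + Real.exp (-z)) / 2) ^ m ≤ Real.exp (-(m / 4)) * Real.exp (-8) ^ d := by
      calc _ ≤ ((1 + Real.exp (-2)) / 2) ^ m := by gcongr
        _ ≤ Real.exp (-(2 / 4)) ^ m := by
          gcongr; exact one_add_exp_neg_div_two_le zero_le_two le_rfl
        _ ≤ _ := by
          rw [← Real.exp_nat_mul, ← Real.exp_nat_mul, ← Real.exp_add, Real.exp_le_exp]
          linarith
    linarith
  · have hz' : 2 * Real.log m ≤ z := by
      rw [hz, div_mul_eq_mul_div, le_div_iff₀ hm0]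
      nlinarith
    have he : Real.exp (-z) ≤ 1 / (m : ℝ) ^ 2 := by
      calc _ ≤ Real.exp (-(2 * Real.log m)) := by gcongr
        _ = _ := by
          rw [Real.exp_neg, mul_comm, Real.exp_mul, Real.exp_log hm0, one_div]
          norm_num
    have h1 : (1 + Real.exp (-z)) ^ m ≤ Real.exp (1 / m) := by
      calc _ ≤ Real.exp (1 / (m : ℝ) ^ 2) ^ m := by
            gcongr
            linarith [Real.add_one_le_exp (1 / (m : ℝ) ^ 2)]
        _ = _ := by
          rw [← Real.exp_nat_mul]
          congr 1
          field_simp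
    have h3 : ((1 + Real.exp (-z)) / 2) ^ m = (1 / 2) ^ m * (1 + Real.exp (-z)) ^ m := by
      rw [← mul_pow]; ring
    rw [h3]
    nlinarith

theorem min_le_rennesBound {k : ℝ} (hk : 1 < k) {m : ℕ} (hm : 2 ≤ m) :
    min (1 / 2) (32 * (Real.log m / m)) ≤ rennesBound k m := by
  have hm0 : (0 : ℝ) < m := by positivity
  have hlog : 0 ≤ Real.log m := Real.log_natCast_nonneg m
  have hlk : 0 < Real.logb 2 k := Real.logb_pos one_lt_two hk
  have hδ : (m : ℝ) / (m + Real.logb 2 k) ∈ Set.Icc (0 : ℝ) 1 :=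
    ⟨by positivity, div_le_one_of_le₀ (by linarith) (by positivity)⟩
  set δ := (m : ℝ) / (m + Real.logb 2 k)
  have hmem := invBinEntropy₂_mem hδ
  have hpos : 0 < invBinEntropy₂ δ := by
    refine hmem.1.lt_of_ne fun h => ?_
    have h' := binEntropy₂_invBinEntropy₂ hδ
    rw [← h] at h'
    have : 0 < δ := by positivity
    simp [binEntropy₂] at h'
    linarith
  refine min_le_min le_rfl ?_
  have h1 : (32 : ℝ) ≤ 16 / invBinEntropy₂ δ := by
    rw [le_div_iff₀ hpos]; linarith [hmem.2]
  have h2 : Real.log m ≤ Real.logb 2 m := by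
    rw [Real.logb, le_div_iff₀ (Real.log_pos one_lt_two)]
    nlinarith [Real.log_two_lt_d9]
  gcongr

theorem IsRennesDensity.one_sub_two_mul_le {n : ℕ} {k : ℝ} (hk : 1 < k) {p : Fin n → I}
    (hp : IsRennesDensity k p) {m : ℕ} (hm : 2 ≤ m) (hmn : m ≤ n) {i : Fin n} (hi : (i : ℕ) < m) :
    1 - 2 * (p i : ℝ) ≤ Real.exp (-(64 * Real.log m / m)) := by
  have h1 : (p ⟨m - 1, by omega⟩ : ℝ) ≤ p i := hp.antitone (Fin.mk_le_mk.2 (by omega))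
  have h2 := hp.bound_le ⟨m - 1, by omega⟩
  simp only [show m - 1 + 1 = m by omega] at h2
  have h3 := (min_le_rennesBound hk hm).trans (h2.trans h1)
  rcases min_le_iff.1 h3 with h | h
  · linarith [Real.exp_pos (-(64 * Real.log m / m))]
  · have := Real.add_one_le_exp (-(64 * Real.log m / m))
    rw [mul_div_assoc] at *
    linarith

theorem one_add_pow_le_exp {a : ℝ} (ha : 0 ≤ a) {n : ℕ} {c : ℝ} (h : n * a ≤ c) :
    (1 + a) ^ n ≤ Real.exp c := by
  calc _ ≤ Real.exp a ^ n := by gcongr; linarith [Real.add_one_le_exp a]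
    _ = Real.exp (n * a) := (Real.exp_nat_mul a n).symm
    _ ≤ _ := Real.exp_le_exp.2 h

theorem sum_collision_excess_le {n : ℕ} {k : ℝ} (hk : 1 < k) {p : Fin n → I}
    (hp : IsRennesDensity k p) {m : ℕ} (hm : 2 ≤ m) (hmn : m ≤ n) (hnm : n ≤ 200 * m)
    {S : Finset (Cube n)} (hS : (S.card : ℝ) ≤ 2 ^ m * k) (x : Cube n) :
    ∑ y ∈ S, (collisionProb p m (hammingDist x y) - (1 / 2) ^ m) ≤
      Real.exp (200 / m) + Real.exp (-(m / 8)) + k * (Real.exp (1 / m) - 1) := by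
  have hm0 : (0 : ℝ) < m := by positivity
  have hnm' : (n : ℝ) ≤ 200 * m := by exact_mod_cast hnm
  set a := Real.exp (-(16 * Real.log m)) with ha
  set b := Real.exp (-8) with hb
  set e := (1 / 2 : ℝ) ^ m * (Real.exp (1 / m) - 1) with he
  have he0 : 0 ≤ e :=
    mul_nonneg (by positivity) (sub_nonneg.2 (Real.one_le_exp (by positivity)))
  have hterm : ∀ y, collisionProb p m (hammingDist x y) - (1 / 2) ^ m ≤
      a ^ hammingDist x y + Real.exp (-(m / 4)) * b ^ hammingDist x y + e := fun y =>
    (sub_le_sub_right (collisionProb_le hmn hp.le_half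
      (fun i hi => hp.one_sub_two_mul_le hk hm hmn hi) _) _).trans (collision_excess_le hm _)
  have hSa : ∑ y ∈ S, a ^ hammingDist x y ≤ Real.exp (200 / m) := by
    refine (Finset.sum_le_univ_sum_of_nonneg fun y => by positivity).trans ?_
    rw [sum_pow_hammingDist]
    refine one_add_pow_le_exp (by positivity) ?_
    have h2 : a ≤ 1 / (m : ℝ) ^ 2 := by
      calc a ≤ Real.exp (-(2 * Real.log m)) := by
            rw [ha]; gcongr; norm_num
        _ = _ := by
          rw [Real.exp_neg, mul_comm, Real.exp_mul, Real.exp_log hm0, one_div]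
          norm_num
    calc (n : ℝ) * a ≤ 200 * m * (1 / (m : ℝ) ^ 2) := by gcongr
      _ = _ := by field_simp
  have hSb : ∑ y ∈ S, b ^ hammingDist x y ≤ Real.exp (m / 8) := by
    refine (Finset.sum_le_univ_sum_of_nonneg fun y => by positivity).trans ?_
    rw [sum_pow_hammingDist]
    refine one_add_pow_le_exp (by positivity) ?_
    have h2 : b ≤ 1 / 1600 := by
      have h1 : (1600 : ℝ) ≤ Real.exp 8 := by
        calc (1600 : ℝ) ≤ 2.7 ^ 8 := by norm_num
          _ ≤ Real.exp 1 ^ 8 := by gcongr; linarith [Real.exp_one_gt_d9]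
          _ = _ := by rw [← Real.exp_nat_mul]; norm_num
      rw [hb, Real.exp_neg, ← one_div]
      gcongr
    calc (n : ℝ) * b ≤ 200 * m * (1 / 1600) := by gcongr
      _ = _ := by ring
  calc _ ≤ ∑ y ∈ S, (a ^ hammingDist x y + Real.exp (-(m / 4)) * b ^ hammingDist x y + e) :=
        Finset.sum_le_sum fun y _ => hterm y
    _ = ∑ y ∈ S, a ^ hammingDist x y + Real.exp (-(m / 4)) * ∑ y ∈ S, b ^ hammingDist x y +
        S.card * e := by
      rw [Finset.sum_add_distrib, Finset.sum_add_distrib, Finset.mul_sum, Finset.sum_const,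
        nsmul_eq_mul]
    _ ≤ Real.exp (200 / m) + Real.exp (-(m / 4)) * Real.exp (m / 8) + 2 ^ m * k * e := by gcongr
    _ = _ := by
      have h1 : Real.exp (-(m / 4 : ℝ)) * Real.exp (m / 8) = Real.exp (-(m / 8)) := by
        rw [← Real.exp_add]; ring_nf
      have h2 : (2 : ℝ) ^ m * (1 / 2) ^ m = 1 := by rw [← mul_pow]; norm_num
      rw [h1, he]
      linear_combination k * (Real.exp (1 / m) - 1) * h2

theorem eventually_dispersion_bound_le (k : ℝ) {ρ : ℝ} (hρ : 1 < ρ) :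
    ∀ᶠ m : ℕ in Filter.atTop,
      Real.exp (200 / m) + Real.exp (-(m / 8)) + k * (Real.exp (1 / m) - 1) ≤ ρ := by
  have hc : ∀ c : ℝ, Filter.Tendsto (fun m : ℕ => Real.exp (c / m)) Filter.atTop (nhds 1) :=
    fun c => by
      simpa [Function.comp_def] using
        (Real.continuous_exp.tendsto 0).comp (tendsto_const_div_atTop_nhds_zero_nat c)
  have he : Filter.Tendsto (fun m : ℕ => Real.exp (-((m : ℝ) / 8))) Filter.atTop (nhds 0) :=
    Real.tendsto_exp_neg_atTop_nhds_zero.comp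
      (tendsto_natCast_atTop_atTop.atTop_div_const (by norm_num))
  have h := ((hc 200).add he).add (((hc 1).sub_const 1).const_mul k)
  rw [sub_self, mul_zero, add_zero, add_zero] at h
  exact h.eventually_le_const hρ

end Hashing

theorem theorem2 (k : ℝ) (hk : 1 < k) (ρ : ℝ) (hρ : 1 < ρ) :
    ∃ n₀ : ℕ, ∀ n : ℕ, n₀ ≤ n →
      ∃ qs : ℕ, qs ≤ n ∧ qs ≤ max n₀ ⌈(n : ℝ) / 200⌉₊ ∧
        ∀ p : Fin n → unitInterval, Hashing.IsRennesDensity k p →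
          (∀ m : ℕ, qs ≤ m → m ≤ n →
            ∀ S : Finset (Hashing.Cube n), (S.card : ℝ) ≤ 2 ^ m * k → ∀ α : Hashing.Cube n,
              ∫ h, Hashing.cellCount S m α h ∂(Hashing.affineHashLaw p) = (S.card : ℝ) / 2 ^ m ∧
              Hashing.dispersionIndex (Hashing.cellCount S m α) (Hashing.affineHashLaw p) ≤ ρ) ∧
          Hashing.PrefixConcentrated (Hashing.affineHashLaw p) ρ qs k := by
  obtain ⟨N, hN⟩ := Filter.eventually_atTop.1 (Hashing.eventually_dispersion_bound_le k hρ)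
  refine ⟨max N 2, fun n hn => ⟨max (max N 2) ⌈(n : ℝ) / 200⌉₊, max_le hn ?_, le_rfl,
    fun p hp => ?_⟩⟩
  · exact Nat.ceil_le.2 (div_le_self n.cast_nonneg (by norm_num))
  have key : ∀ m : ℕ, max (max N 2) ⌈(n : ℝ) / 200⌉₊ ≤ m → m ≤ n →
      ∀ S : Finset (Hashing.Cube n), (S.card : ℝ) ≤ 2 ^ m * k → ∀ α : Hashing.Cube n,
        ∫ h, Hashing.cellCount S m α h ∂(Hashing.affineHashLaw p) = (S.card : ℝ) / 2 ^ m ∧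
        Hashing.dispersionIndex (Hashing.cellCount S m α) (Hashing.affineHashLaw p) ≤ ρ := by
    intro m hm hmn S hS α
    obtain ⟨h1, h2⟩ := max_le_iff.1 hm
    obtain ⟨hNm, h2m⟩ := max_le_iff.1 h1
    have hnm : n ≤ 200 * m := by
      have := (div_le_iff₀ (by norm_num)).1 (Nat.ceil_le.1 h2)
      rw [mul_comm] at this
      exact_mod_cast this
    exact ⟨Hashing.integral_cellCount p hmn S α,
      Hashing.dispersionIndex_cellCount_le p hmn S α (by linarith) fun x _ =>
        (Hashing.sum_collision_excess_le hk hp h2m hmn hnm hS x).trans (hN m hNm)⟩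
  exact ⟨key, fun m hm hmn S hS α => key m hm hmn S (by rwa [mul_comm]) α⟩
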